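/- There is an absolute constant $C>0$ such that the following holds. Let $m,n\ge 1$ be integers, let $t\ge 1$ be a real number, and let $M$ be an $m\times n$ matrix with nonnegative integer entries, of rank $r$ over $\mathbb{R}$, whose average entry $\frac{1}{mn}\sum_{i=1}^m\sum_{j=1}^n M(i,j)$ is at most $t$. Then $M$ contains a constant submatrix of size at least $2^{-Ct\sqrt r}\,m\times 2^{-Ct\sqrt r}\,n$; that is, there are sets $R\subseteq\{1,\dots,m\}$ and $S\subseteq\{1,\dots,n\}$ with $|R|\ge 2^{-Ct\sqrt r}\,m$ and $|S|\ge 2^{-Ct\sqrt r}\,n$ such that $M(i,j)$ takes the same value for all $i\in R$ and $j\in S$. -/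

import Mathlib

noncomputable section

/-- The average entry of an `m × n` matrix of natural numbers, as a real number. -/
def averageEntry {m n : ℕ} (M : Matrix (Fin m) (Fin n) ℕ) : ℝ :=
  (∑ i, ∑ j, (M i j : ℝ)) / ((m : ℝ) * (n : ℝ))

/-- The rank over `ℝ` of a matrix of natural numbers. -/
def realRank {m n : ℕ} (M : Matrix (Fin m) (Fin n) ℕ) : ℕ :=
  (M.map (fun x : ℕ => (x : ℝ))).rank

/-- The submatrix of `M` with row set `R` and column set `S` (arbitrary, not necessarily
contiguous, sets of indices) is constant: all its entries are equal to one number. -/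
def IsConstantSubmatrix {m n : ℕ} (M : Matrix (Fin m) (Fin n) ℕ)
    (R : Finset (Fin m)) (S : Finset (Fin n)) : Prop :=
  ∃ k : ℕ, ∀ i ∈ R, ∀ j ∈ S, M i j = k

end

/-!
The average `p` of `M` is lowered step by step by passing to submatrices, each with at least a third
of the rows and of the columns, until a submatrix is so close to a constant `k` that low rank makes
a large part of it equal to `k`.

*Single step* (`exists_const_submatrix_or_average_drop`). Put `B = M - p`, a matrix of rank at most
`D = r + 1` with entries summing to zero. Grothendieck's inequality in its factorised form
(`exists_dominating_weights`) provides diagonal forms of equal trace `γ` dominating the bilinear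
form of `B`, where `γ / 8` is attained by `B` on scalars in `[-1, 1]`. The weights come from a
maximiser of the vector relaxation `∑ B i j ⟪x i, y j⟫`: tilting all vectors towards an extra
orthogonal direction shows that the diagonal forms dominate, and a truncated Rademacher rounding
whose error is bounded by those same forms yields the scalars. This has two consequences.

* The attained value gives a submatrix of proportional size with average at most `p - δ`,
  where `δ` is a constant multiple of `η = γ / (m n)` (`exists_thirds_sum_le`).
* On the rows and columns carrying at most twice the average weight, `B` has operator norm at most
  `2 γ / √(m n)`, so its rank bounds the mean of `B ^ 2` there by `16 D η ^ 2`
  (`exists_light_submatrix`). Let `k` be a nearest integer to `p`. Since the entries are integers,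
  the mean of `|M - k|` is at most `64 D η ^ 2`. If this is at most `1 / (8 D)`, a basis of sparse
  columns exhibits a large submatrix equal to `k` (`exists_zero_submatrix_of_sparse`). Otherwise
  `η` is at least of order `1 / D`, and it is at least of order `√(|p - k| / D)` because the average
  of the light part is within `4 η` of `p`.

*Iteration.* At distance `d` from the nearest integer the average drops by at least a constant
times `max (1 / D) √(d / D)`. As `d ^ (-1 / 2)` is integrable at zero, crossing a unit interval takes
`O(√D)` steps, so that `O(t √r)` steps suffice. The integral is replaced by the grid of points
`k + j |j| / (2 q ^ 2)` with `|j| ≤ q` and `q` of order `√D`, of which every step passes at least one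
(`ConstSubmatrixBound.cross`).
-/

/-! ### Second-order optimality for the vector relaxation of a bilinear form -/

/-- The polynomial `1 - u / 2 - u ^ 2 / 2` is a lower bound for `√(1 - u)` on `[0, 1]`; it
replaces the square root in the perturbation of unit vectors. -/
lemma sq_one_sub_half_sub_add_le {u : ℝ} (h0 : 0 ≤ u) (h1 : u ≤ 1) :
    (1 - u * (1 / 2 + u / 2)) ^ 2 + u ≤ 1 := by
  have h : 0 ≤ u ^ 2 * ((1 - u) * (3 + u)) :=
    mul_nonneg (sq_nonneg u) (mul_nonneg (by linarith) (by linarith))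
  nlinarith [h]

/-- The maximum of `∑ B i j ⟪x i, y j⟫` over vectors of norm at most one is attained. -/
lemma exists_isMaxOn_vectorForm {ι κ E : Type*} [Fintype ι] [Fintype κ]
    [NormedAddCommGroup E] [InnerProductSpace ℝ E] [FiniteDimensional ℝ E] (B : ι → κ → ℝ) :
    ∃ (x : ι → E) (y : κ → E), (∀ i, ‖x i‖ ≤ 1) ∧ (∀ j, ‖y j‖ ≤ 1) ∧
      ∀ (x' : ι → E) (y' : κ → E), (∀ i, ‖x' i‖ ≤ 1) → (∀ j, ‖y' j‖ ≤ 1) →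
        ∑ i, ∑ j, B i j * inner ℝ (x' i) (y' j) ≤ ∑ i, ∑ j, B i j * inner ℝ (x i) (y j) := by
  have : ProperSpace E := FiniteDimensional.proper ℝ E
  have hK : IsCompact ((Set.univ.pi fun _ : ι => Metric.closedBall (0 : E) 1) ×ˢ
      (Set.univ.pi fun _ : κ => Metric.closedBall (0 : E) 1)) :=
    (isCompact_univ_pi fun _ => isCompact_closedBall _ _).prod
      (isCompact_univ_pi fun _ => isCompact_closedBall _ _)
  obtain ⟨z, hz, hmax⟩ := hK.exists_isMaxOn (f := fun z : (ι → E) × (κ → E) =>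
      ∑ i, ∑ j, B i j * inner ℝ (z.1 i) (z.2 j)) ⟨0, by simp⟩
      (by fun_prop)
  simp only [Set.mem_prod, Set.mem_univ_pi, mem_closedBall_zero_iff] at hz
  refine ⟨z.1, z.2, hz.1, hz.2, fun x' y' hx hy => ?_⟩
  exact hmax (a := (x', y')) (by simpa using ⟨hx, hy⟩)

/-- Fewer vectors than the dimension leave a unit vector orthogonal to all of them. -/
lemma exists_unit_orthogonal {ι E : Type*} [Fintype ι]
    [NormedAddCommGroup E] [InnerProductSpace ℝ E] [FiniteDimensional ℝ E] (v : ι → E)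
    (h : Fintype.card ι < Module.finrank ℝ E) :
    ∃ e : E, ‖e‖ = 1 ∧ ∀ i, inner ℝ (v i) e = 0 := by
  have hlt : Module.finrank ℝ (Submodule.span ℝ (Set.range v)) < Module.finrank ℝ E :=
    (finrank_range_le_card v).trans_lt h
  have hne : (Submodule.span ℝ (Set.range v))ᗮ ≠ ⊥ := by
    intro hbot
    rw [Submodule.orthogonal_eq_bot_iff] at hbot
    rw [hbot, finrank_top] at hlt
    exact lt_irrefl _ hlt
  obtain ⟨e, he, he0⟩ := Submodule.exists_mem_ne_zero_of_ne_bot hne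
  refine ⟨(‖e‖⁻¹ : ℝ) • e, norm_smul_inv_norm he0, fun i => ?_⟩
  rw [inner_smul_right, (Submodule.mem_orthogonal _ e).1 he (v i)
    (Submodule.subset_span ⟨i, rfl⟩), mul_zero]

/-- At a maximiser of the vector relaxation, the terms `c i j = B i j ⟪x i, y j⟫` dominate the
scalar form. All vectors are tilted towards a direction `e` orthogonal to every one of them: to
second order the objective changes by `∑ B i j f i g j - ∑ c i j (f i ^ 2 + g j ^ 2) / 2`, which is
therefore nonpositive. -/
lemma vectorForm_second_order {ι κ E : Type*} [Fintype ι] [Fintype κ]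
    [NormedAddCommGroup E] [InnerProductSpace ℝ E] (B : ι → κ → ℝ)
    {x : ι → E} {y : κ → E} (hx : ∀ i, ‖x i‖ ≤ 1) (hy : ∀ j, ‖y j‖ ≤ 1)
    (hmax : ∀ (x' : ι → E) (y' : κ → E), (∀ i, ‖x' i‖ ≤ 1) → (∀ j, ‖y' j‖ ≤ 1) →
        ∑ i, ∑ j, B i j * inner ℝ (x' i) (y' j) ≤ ∑ i, ∑ j, B i j * inner ℝ (x i) (y j))
    {e : E} (he : ‖e‖ = 1) (hxe : ∀ i, inner ℝ (x i) e = 0) (hye : ∀ j, inner ℝ (y j) e = 0)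
    (f : ι → ℝ) (g : κ → ℝ) :
    ∑ i, ∑ j, B i j * (f i * g j) ≤
      ∑ i, ∑ j, B i j * inner ℝ (x i) (y j) * ((f i ^ 2 + g j ^ 2) / 2) := by
  set a : ℝ → ℝ := fun u => 1 / 2 + u / 2 with ha
  have norm_tilt : ∀ (v : E) (s c : ℝ), ‖v‖ ≤ 1 → inner ℝ v e = 0 → (s * c) ^ 2 ≤ 1 →
      ‖(1 - s ^ 2 * c ^ 2 * a (s ^ 2 * c ^ 2)) • v + (s * c) • e‖ ≤ 1 := by
    intro v s c hv hve hsc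
    have hu : s ^ 2 * c ^ 2 ≤ 1 := by rwa [← mul_pow]
    have h1 := sq_one_sub_half_sub_add_le (u := s ^ 2 * c ^ 2) (by positivity) hu
    rw [← sq_le_one_iff₀ (norm_nonneg _), norm_add_sq_real, norm_smul, norm_smul, inner_smul_left,
      inner_smul_right, hve, he, mul_pow, Real.norm_eq_abs, sq_abs, Real.norm_eq_abs]
    have h2 : ‖v‖ ^ 2 ≤ 1 := by rwa [sq_le_one_iff₀ (norm_nonneg _)]
    have h3 : (1 - s ^ 2 * c ^ 2 * a (s ^ 2 * c ^ 2)) ^ 2 * ‖v‖ ^ 2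
        ≤ (1 - s ^ 2 * c ^ 2 * a (s ^ 2 * c ^ 2)) ^ 2 :=
      mul_le_of_le_one_right (sq_nonneg _) h2
    simp only [mul_zero, add_zero, mul_one, sq_abs]
    simp only [ha] at h3 ⊢
    nlinarith [h1, h3]
  -- The objective at the tilted vectors, with `T` the square of the tilt.
  set φ : ℝ → ℝ := fun T => ∑ i, ∑ j, B i j * inner ℝ (x i) (y j) *
    (f i ^ 2 * a (T * f i ^ 2) + g j ^ 2 * a (T * g j ^ 2)
      - T * (f i ^ 2 * a (T * f i ^ 2) * (g j ^ 2 * a (T * g j ^ 2)))) with hφ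
  have hcont : Continuous φ := by
    simp only [hφ, ha]
    fun_prop
  have h0 : φ 0 = ∑ i, ∑ j, B i j * inner ℝ (x i) (y j) * ((f i ^ 2 + g j ^ 2) / 2) := by
    simp only [hφ, ha]
    refine Finset.sum_congr rfl fun i _ => Finset.sum_congr rfl fun j _ => ?_
    ring
  rw [← h0]
  have htend : Filter.Tendsto (fun s : ℝ => φ (s ^ 2)) (nhdsWithin 0 (Set.Ioi 0)) (nhds (φ 0)) := by
    have : Continuous fun s : ℝ => φ (s ^ 2) := by fun_prop
    have h := this.tendsto 0
    simp only [ne_eq, OfNat.ofNat_ne_zero, not_false_eq_true, zero_pow] at h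
    exact h.mono_left nhdsWithin_le_nhds
  refine ge_of_tendsto htend ?_
  have hsmall : ∀ c : ℝ, ∀ᶠ s in nhdsWithin (0 : ℝ) (Set.Ioi 0), (s * c) ^ 2 ≤ 1 := by
    intro c
    have h : Filter.Tendsto (fun s : ℝ => (s * c) ^ 2) (nhds 0) (nhds 0) := by
      have : Continuous fun s : ℝ => (s * c) ^ 2 := by fun_prop
      simpa using this.tendsto 0
    exact ((h.eventually (ge_mem_nhds one_pos))).filter_mono nhdsWithin_le_nhds
  filter_upwards [self_mem_nhdsWithin, Filter.eventually_all.2 fun i => hsmall (f i),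
    Filter.eventually_all.2 fun j => hsmall (g j)] with s hs hf hg
  have hs0 : (0 : ℝ) < s := hs
  have h := hmax (fun i => (1 - s ^ 2 * f i ^ 2 * a (s ^ 2 * f i ^ 2)) • x i + (s * f i) • e)
    (fun j => (1 - s ^ 2 * g j ^ 2 * a (s ^ 2 * g j ^ 2)) • y j + (s * g j) • e)
    (fun i => norm_tilt _ _ _ (hx i) (hxe i) (hf i))
    (fun j => norm_tilt _ _ _ (hy j) (hye j) (hg j))
  have hee : inner ℝ e e = 1 := by rw [real_inner_self_eq_norm_sq, he, one_pow]
  have hey : ∀ j, inner ℝ e (y j) = 0 := fun j => by rw [real_inner_comm]; exact hye j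
  simp only [inner_add_left, inner_add_right, inner_smul_left, inner_smul_right, hxe, hey, hee,
    mul_zero, add_zero, zero_add, mul_one, conj_trivial] at h
  have key : s ^ 2 * (φ (s ^ 2) - ∑ i, ∑ j, B i j * (f i * g j)) =
      ∑ i, ∑ j, B i j * inner ℝ (x i) (y j) - ∑ i, ∑ j, B i j *
        ((1 - s ^ 2 * g j ^ 2 * a (s ^ 2 * g j ^ 2)) * ((1 - s ^ 2 * f i ^ 2 * a (s ^ 2 * f i ^ 2)) *
          inner ℝ (x i) (y j)) + s * g j * (s * f i)) := by
    simp only [hφ, ← Finset.sum_sub_distrib, Finset.mul_sum]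
    refine Finset.sum_congr rfl fun i _ => Finset.sum_congr rfl fun j _ => ?_
    ring
  have h2 : 0 ≤ s ^ 2 * (φ (s ^ 2) - ∑ i, ∑ j, B i j * (f i * g j)) := by
    rw [key]; linarith
  have := nonneg_of_mul_nonneg_right h2 (by positivity)
  linarith

/-! ### Rounding vectors to bounded scalars -/

/-- The Rademacher sum `∑ ± a k` with the signs prescribed by `ε`. -/
def signSum {N : ℕ} (a : Fin N → ℝ) (ε : Fin N → Bool) : ℝ :=
  ∑ k, (if ε k then 1 else -1) * a k

lemma sum_signs_succ {N : ℕ} (F : (Fin (N + 1) → Bool) → ℝ) :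
    ∑ ε, F ε = ∑ ε : Fin N → Bool, (F (Fin.cons true ε) + F (Fin.cons false ε)) := by
  rw [← (Fin.consEquiv fun _ : Fin (N + 1) => Bool).sum_comp, Fintype.sum_prod_type]
  simp [Fin.consEquiv, Finset.sum_add_distrib]

lemma signSum_cons_true {N : ℕ} (a : Fin (N + 1) → ℝ) (ε : Fin N → Bool) :
    signSum a (Fin.cons true ε) = a 0 + signSum (fun k => a k.succ) ε := by
  simp [signSum, Fin.sum_univ_succ]

lemma signSum_cons_false {N : ℕ} (a : Fin (N + 1) → ℝ) (ε : Fin N → Bool) :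
    signSum a (Fin.cons false ε) = -a 0 + signSum (fun k => a k.succ) ε := by
  simp [signSum, Fin.sum_univ_succ]

lemma sum_signSum_mul {N : ℕ} (a b : Fin N → ℝ) :
    ∑ ε, signSum a ε * signSum b ε = 2 ^ N * ∑ k, a k * b k := by
  induction N with
  | zero => simp [signSum]
  | succ N ih =>
    rw [sum_signs_succ]
    simp only [signSum_cons_true, signSum_cons_false]
    have h := ih (fun k => a k.succ) (fun k => b k.succ)
    calc _ = ∑ ε : Fin N → Bool, (2 * (a 0 * b 0) +
          2 * (signSum (fun k => a k.succ) ε * signSum (fun k => b k.succ) ε)) :=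
          Finset.sum_congr rfl fun ε _ => by ring
      _ = _ := by
          simp only [Finset.sum_add_distrib, ← Finset.mul_sum, h, Fin.sum_univ_succ]
          simp
          ring

lemma sum_signSum_pow_four_le {N : ℕ} (a : Fin N → ℝ) :
    ∑ ε, signSum a ε ^ 4 ≤ 2 ^ N * (3 * (∑ k, a k ^ 2) ^ 2) := by
  induction N with
  | zero => simp [signSum]
  | succ N ih =>
    rw [sum_signs_succ]
    simp only [signSum_cons_true, signSum_cons_false]
    have h := ih (fun k => a k.succ)
    have h2 := sum_signSum_mul (fun k => a k.succ) (fun k => a k.succ)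
    calc _ = ∑ ε : Fin N → Bool, (2 * a 0 ^ 4 + 12 * a 0 ^ 2 *
          (signSum (fun k => a k.succ) ε * signSum (fun k => a k.succ) ε) +
          2 * signSum (fun k => a k.succ) ε ^ 4) :=
          Finset.sum_congr rfl fun ε _ => by ring
      _ = 2 ^ N * (2 * a 0 ^ 4 + 12 * a 0 ^ 2 * ∑ k : Fin N, a k.succ ^ 2) +
          2 * ∑ ε, signSum (fun k => a k.succ) ε ^ 4 := by
          simp only [Finset.sum_add_distrib, ← Finset.mul_sum, h2]
          simp [sq]
          ring
      _ ≤ _ := by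
          rw [Fin.sum_univ_succ, pow_succ (2 : ℝ) N]
          have : (0 : ℝ) ≤ 2 ^ N * a 0 ^ 4 := by positivity
          nlinarith [h, this]

/-- Truncation of a real number to `[-2, 2]`. -/
def clipTwo (x : ℝ) : ℝ := max (-2) (min 2 x)

lemma abs_clipTwo_le_two (x : ℝ) : |clipTwo x| ≤ 2 :=
  abs_le.2 ⟨le_max_left _ _, max_le (by norm_num) (min_le_left _ _)⟩

lemma clipTwo_sq_le (x : ℝ) : clipTwo x ^ 2 ≤ x ^ 2 := by
  unfold clipTwo
  rcases le_total x 2 with h | h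
  · rw [min_eq_right h]
    rcases le_total (-2) x with h' | h'
    · rw [max_eq_right h']
    · rw [max_eq_left h']; nlinarith
  · rw [min_eq_left h]; norm_num; nlinarith

/-- The part removed by truncation at height `2` is controlled by the fourth power, since
`|x| - 2 ≤ x ^ 2 / 8`. -/
lemma sub_clipTwo_sq_le (x : ℝ) : (x - clipTwo x) ^ 2 ≤ x ^ 4 / 64 := by
  have hx4 : (x ^ 2 / 8) ^ 2 = x ^ 4 / 64 := by ring
  rw [← hx4]
  apply sq_le_sq'
  all_goals
    unfold clipTwo
    rcases le_total x 2 with h | h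
    · rw [min_eq_right h]
      rcases le_total (-2) x with h' | h'
      · rw [max_eq_right h']; nlinarith [sq_nonneg x]
      · rw [max_eq_left h']; nlinarith [sq_nonneg (x + 4), sq_nonneg x]
    · rw [min_eq_left h]; norm_num; nlinarith [sq_nonneg (x - 4), sq_nonneg x]

lemma sum_weighted_sq_le {Ω τ : Type*} [Fintype Ω] [Fintype τ] (w : τ → ℝ) (Z : τ → Ω → ℝ) (c : ℝ)
    (hw : ∀ t, 0 ≤ w t) (hZ : ∀ t, ∑ ε, Z t ε ^ 2 ≤ c) :
    ∑ ε, ∑ t, w t * Z t ε ^ 2 ≤ (∑ t, w t) * c := by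
  rw [Finset.sum_comm, Finset.sum_mul]
  refine Finset.sum_le_sum fun t _ => ?_
  rw [← Finset.mul_sum]
  exact mul_le_mul_of_nonneg_left (hZ t) (hw t)

/-- Rounding with a domination hypothesis: if `∑ B i j f i g j` is bounded by a diagonal form of
trace `∑ B i j ⟪x i, y j⟫` on either side, then replacing the vectors by their truncated
Rademacher images loses only a constant factor, because the diagonal form bounds the
contribution of the truncated parts. -/
lemma exists_bounded_scalars_of_vectorForm {ι κ : Type*} [Fintype ι] [Fintype κ] {N : ℕ}
    (B : ι → κ → ℝ) {x : ι → EuclideanSpace ℝ (Fin N)} {y : κ → EuclideanSpace ℝ (Fin N)}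
    (hx : ∀ i, ‖x i‖ ≤ 1) (hy : ∀ j, ‖y j‖ ≤ 1) {lam : ι → ℝ} {mu : κ → ℝ} {γ : ℝ}
    (hlam0 : ∀ i, 0 ≤ lam i) (hmu0 : ∀ j, 0 ≤ mu j)
    (hlam : ∑ i, lam i = γ) (hmu : ∑ j, mu j = γ)
    (hγ : ∑ i, ∑ j, B i j * inner ℝ (x i) (y j) = γ)
    (hdom : ∀ (f : ι → ℝ) (g : κ → ℝ), ∑ i, ∑ j, B i j * (f i * g j) ≤
      (∑ i, lam i * f i ^ 2 + ∑ j, mu j * g j ^ 2) / 2) :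
    ∃ (f : ι → ℝ) (g : κ → ℝ), (∀ i, |f i| ≤ 1) ∧ (∀ j, |g j| ≤ 1) ∧
      γ / 8 ≤ ∑ i, ∑ j, B i j * (f i * g j) := by
  set X : ι → (Fin N → Bool) → ℝ := fun i => signSum (x i) with hX
  set Y : κ → (Fin N → Bool) → ℝ := fun j => signSum (y j) with hY
  have nsq : ∀ v : EuclideanSpace ℝ (Fin N), ‖v‖ ≤ 1 → ∑ k, v k ^ 2 ≤ 1 := by
    intro v hv
    have := EuclideanSpace.real_norm_sq_eq v
    rw [← this]
    exact (sq_le_one_iff₀ (norm_nonneg _)).2 hv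
  have second : ∀ v : EuclideanSpace ℝ (Fin N), ‖v‖ ≤ 1 →
      ∑ ε, signSum v ε ^ 2 ≤ 2 ^ N := by
    intro v hv
    have h := sum_signSum_mul v v
    simp only [← sq] at h
    rw [h]
    exact mul_le_of_le_one_right (by positivity) (nsq v hv)
  have tail : ∀ v : EuclideanSpace ℝ (Fin N), ‖v‖ ≤ 1 →
      ∑ ε, (signSum v ε - clipTwo (signSum v ε)) ^ 2 ≤ 2 ^ N * (3 / 64) := by
    intro v hv
    calc _ ≤ ∑ ε, signSum v ε ^ 4 / 64 := Finset.sum_le_sum fun ε _ => sub_clipTwo_sq_le _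
      _ = (∑ ε, signSum v ε ^ 4) / 64 := by rw [Finset.sum_div]
      _ ≤ (2 ^ N * (3 * (∑ k, v k ^ 2) ^ 2)) / 64 := by gcongr; exact sum_signSum_pow_four_le _
      _ ≤ (2 ^ N * (3 * 1 ^ 2)) / 64 := by gcongr; exact nsq v hv
      _ = _ := by ring
  have clipped : ∀ v : EuclideanSpace ℝ (Fin N), ‖v‖ ≤ 1 →
      ∑ ε, clipTwo (signSum v ε) ^ 2 ≤ 2 ^ N := fun v hv =>
    (Finset.sum_le_sum fun ε _ => clipTwo_sq_le _).trans (second v hv)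
  -- Summed over all signs, the untruncated form has value `2 ^ N * γ`.
  have total : ∑ ε, ∑ i, ∑ j, B i j * (X i ε * Y j ε) = 2 ^ N * γ := by
    rw [← hγ, Finset.sum_comm, Finset.mul_sum]
    refine Finset.sum_congr rfl fun i _ => ?_
    rw [Finset.sum_comm, Finset.mul_sum]
    refine Finset.sum_congr rfl fun j _ => ?_
    rw [← Finset.mul_sum, hX, hY, sum_signSum_mul]
    simp only [PiLp.inner_apply, RCLike.inner_apply, conj_trivial]
    simp only [mul_comm (x i _)]
    ring
  -- The factors `2` and `1 / 2` balance the second moment `3 / 64` of the tail against the bound `1`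
  -- for the other factor.
  have pointwise : ∀ ε, ∑ i, ∑ j, B i j * (X i ε * Y j ε) ≤
      ∑ i, ∑ j, B i j * (clipTwo (X i ε) * clipTwo (Y j ε)) +
      ((4 * ∑ i, lam i * (X i ε - clipTwo (X i ε)) ^ 2 + 1 / 4 * ∑ j, mu j * Y j ε ^ 2) / 2 +
       (1 / 4 * ∑ i, lam i * clipTwo (X i ε) ^ 2 +
          4 * ∑ j, mu j * (Y j ε - clipTwo (Y j ε)) ^ 2) / 2) := by
    intro ε
    have h1 := hdom (fun i => 2 * (X i ε - clipTwo (X i ε))) (fun j => 1 / 2 * Y j ε)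
    have h2 := hdom (fun i => 1 / 2 * clipTwo (X i ε)) (fun j => 2 * (Y j ε - clipTwo (Y j ε)))
    have e : ∑ i, ∑ j, B i j * (X i ε * Y j ε) =
        ∑ i, ∑ j, B i j * (clipTwo (X i ε) * clipTwo (Y j ε)) +
        (∑ i, ∑ j, B i j * ((2 * (X i ε - clipTwo (X i ε))) * (1 / 2 * Y j ε)) +
         ∑ i, ∑ j, B i j * ((1 / 2 * clipTwo (X i ε)) * (2 * (Y j ε - clipTwo (Y j ε))))) := by
      simp only [← Finset.sum_add_distrib]
      refine Finset.sum_congr rfl fun i _ => Finset.sum_congr rfl fun j _ => ?_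
      ring
    rw [e]
    simp only [Finset.mul_sum]
    refine add_le_add le_rfl (add_le_add (h1.trans_eq ?_) (h2.trans_eq ?_))
    · congr 1
      refine congrArg₂ (· + ·) ?_ ?_ <;> refine Finset.sum_congr rfl fun i _ => ?_ <;> ring
    · congr 1
      refine congrArg₂ (· + ·) ?_ ?_ <;> refine Finset.sum_congr rfl fun i _ => ?_ <;> ring
  have hsum := Finset.sum_le_sum fun ε (_ : ε ∈ Finset.univ) => pointwise ε
  rw [total] at hsum
  simp only [Finset.sum_add_distrib, ← Finset.sum_div, ← Finset.mul_sum] at hsum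
  have w1 := sum_weighted_sq_le lam (fun i ε => X i ε - clipTwo (X i ε)) _
    hlam0 fun i => tail (x i) (hx i)
  have w2 := sum_weighted_sq_le mu Y _ hmu0 fun j => second (y j) (hy j)
  have w3 := sum_weighted_sq_le lam (fun i ε => clipTwo (X i ε)) _
    hlam0 fun i => clipped (x i) (hx i)
  have w4 := sum_weighted_sq_le mu (fun j ε => Y j ε - clipTwo (Y j ε)) _
    hmu0 fun j => tail (y j) (hy j)
  rw [hlam] at w1 w3
  rw [hmu] at w2 w4
  have hγ0 : 0 ≤ γ := hlam ▸ Finset.sum_nonneg fun i _ => hlam0 i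
  have hbig : ∑ _ε : Fin N → Bool, γ / 2 ≤
      ∑ ε, ∑ i, ∑ j, B i j * (clipTwo (X i ε) * clipTwo (Y j ε)) := by
    have : ∑ _ε : Fin N → Bool, γ / 2 = 2 ^ N * γ / 2 := by simp; ring
    rw [this]
    have : (0 : ℝ) ≤ 2 ^ N * γ := by positivity
    linarith
  obtain ⟨ε, -, hε⟩ := Finset.exists_le_of_sum_le ⟨fun _ => true, Finset.mem_univ _⟩ hbig
  have half : ∀ z : ℝ, |clipTwo z / 2| ≤ 1 := fun z => by
    rw [abs_div, abs_two]
    linarith [abs_clipTwo_le_two z]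
  refine ⟨fun i => clipTwo (X i ε) / 2, fun j => clipTwo (Y j ε) / 2, fun i => half _,
    fun j => half _, ?_⟩
  have e : ∑ i, ∑ j, B i j * (clipTwo (X i ε) / 2 * (clipTwo (Y j ε) / 2)) =
      (∑ i, ∑ j, B i j * (clipTwo (X i ε) * clipTwo (Y j ε))) / 4 := by
    simp only [Finset.sum_div]
    refine Finset.sum_congr rfl fun i _ => Finset.sum_congr rfl fun j _ => ?_
    ring
  rw [e]
  linarith

/-- Grothendieck's inequality together with its factorisation: a real matrix `B` is dominated by
diagonal forms of equal traces `γ`, and `γ` is, up to a constant, attained by `B` on scalars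
in `[-1, 1]`. -/
theorem exists_dominating_weights {ι κ : Type*} [Fintype ι] [Fintype κ] (B : ι → κ → ℝ) :
    ∃ (lam : ι → ℝ) (mu : κ → ℝ) (γ : ℝ), (∀ i, 0 ≤ lam i) ∧ (∀ j, 0 ≤ mu j) ∧
      ∑ i, lam i = γ ∧ ∑ j, mu j = γ ∧
      (∀ (f : ι → ℝ) (g : κ → ℝ), ∑ i, ∑ j, B i j * (f i * g j) ≤
        (∑ i, lam i * f i ^ 2 + ∑ j, mu j * g j ^ 2) / 2) ∧
      ∃ (f : ι → ℝ) (g : κ → ℝ), (∀ i, |f i| ≤ 1) ∧ (∀ j, |g j| ≤ 1) ∧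
        γ / 8 ≤ ∑ i, ∑ j, B i j * (f i * g j) := by
  classical
  -- One dimension more than the number of vectors leaves room for the orthogonal direction.
  obtain ⟨x, y, hx, hy, hmax⟩ := exists_isMaxOn_vectorForm
    (E := EuclideanSpace ℝ (Fin (Fintype.card (ι ⊕ κ) + 1))) B
  obtain ⟨e, he, horth⟩ := exists_unit_orthogonal (Sum.elim x y) (by simp)
  have h2 := vectorForm_second_order B hx hy hmax he (fun i => horth (Sum.inl i))
    (fun j => horth (Sum.inr j))
  set c : ι → κ → ℝ := fun i j => B i j * inner ℝ (x i) (y j) with hc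
  have hdom : ∀ (f : ι → ℝ) (g : κ → ℝ), ∑ i, ∑ j, B i j * (f i * g j) ≤
      (∑ i, (∑ j, c i j) * f i ^ 2 + ∑ j, (∑ i, c i j) * g j ^ 2) / 2 := by
    intro f g
    refine (h2 f g).trans_eq ?_
    simp only [Finset.sum_mul]
    rw [Finset.sum_comm (s := (Finset.univ : Finset κ)), ← Finset.sum_add_distrib, Finset.sum_div]
    refine Finset.sum_congr rfl fun i _ => ?_
    rw [← Finset.sum_add_distrib, Finset.sum_div]
    refine Finset.sum_congr rfl fun j _ => ?_
    simp only [hc]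
    ring
  have hl : ∀ i, 0 ≤ ∑ j, c i j := by
    intro i
    have := hdom (Pi.single i 1) 0
    simp [Pi.single_apply] at this
    linarith
  have hm : ∀ j, 0 ≤ ∑ i, c i j := by
    intro j
    have := hdom 0 (Pi.single j 1)
    simp [Pi.single_apply] at this
    linarith
  exact ⟨_, _, _, hl, hm, rfl, Finset.sum_comm, hdom,
    exists_bounded_scalars_of_vectorForm B hx hy hl hm rfl Finset.sum_comm rfl hdom⟩

/-! ### From bounded weights to large index sets -/

/-- The `l` smallest values of a finite family have at most the average of the whole family. -/
lemma exists_subset_card_eq_sum_le {ι : Type*} [DecidableEq ι] (β : ι → ℝ) (P : Finset ι) (l : ℕ)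
    (hl : l ≤ P.card) : ∃ T ⊆ P, T.card = l ∧ P.card * ∑ i ∈ T, β i ≤ l * ∑ i ∈ P, β i := by
  induction P using Finset.strongInduction with
  | H P ih =>
    rcases hl.eq_or_lt with rfl | hlt
    · exact ⟨P, subset_rfl, rfl, le_rfl⟩
    have hne : P.Nonempty := Finset.card_pos.1 (by omega)
    obtain ⟨a, ha, hmax⟩ := P.exists_max_image β hne
    have hcard := Finset.card_erase_add_one ha
    obtain ⟨T, hT, hTc, hle⟩ := ih (P.erase a) (Finset.erase_ssubset ha) (by omega)
    refine ⟨T, hT.trans (Finset.erase_subset _ _), hTc, ?_⟩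
    have hsum := Finset.add_sum_erase P β ha
    have hTa : ∑ i ∈ T, β i ≤ l * β a := by
      rw [← hTc, ← nsmul_eq_mul]
      exact Finset.sum_le_card_nsmul T β _ fun i hi =>
        hmax i (Finset.mem_of_mem_erase (hT hi))
    have hc : (P.card : ℝ) = (P.erase a).card + 1 := by exact_mod_cast hcard.symm
    rw [hc, ← hsum]
    linarith

/-- A negative value of a linear form at weights in `[1/3, 1]` is matched by a set of at least a
third of the indices: all indices with negative coefficient, together with the smallest third
of the others. Since there is at least one negative coefficient, rounding the third down does no
harm. -/
lemma exists_third_sum_le {ι : Type*} [Fintype ι] (β a : ι → ℝ)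
    (ha : ∀ i, 1 / 3 ≤ a i) (ha' : ∀ i, a i ≤ 1) (hneg : ∑ i, a i * β i ≤ 0)
    [Nonempty ι] :
    ∃ R : Finset ι, Fintype.card ι ≤ 3 * R.card ∧ ∑ i ∈ R, β i ≤ ∑ i, a i * β i := by
  classical
  set N := Finset.univ.filter fun i => β i < 0 with hN
  set P := Finset.univ.filter fun i => ¬ β i < 0 with hP
  have hcard : N.card + P.card = Fintype.card ι := by
    exact (Finset.card_filter_add_card_filter_not fun i => β i < 0).trans Finset.card_univ
  have hP0 : 0 ≤ ∑ i ∈ P, β i :=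
    Finset.sum_nonneg fun i hi => not_lt.1 (Finset.mem_filter.1 hi).2
  have hsplit : ∑ i ∈ N, a i * β i + ∑ i ∈ P, a i * β i = ∑ i, a i * β i :=
    Finset.sum_filter_add_sum_filter_not _ _ _
  have h1 : ∑ i ∈ N, β i ≤ ∑ i ∈ N, a i * β i := Finset.sum_le_sum fun i hi => by
    have := (Finset.mem_filter.1 hi).2
    nlinarith [ha' i]
  have h2 : (∑ i ∈ P, β i) / 3 ≤ ∑ i ∈ P, a i * β i := by
    rw [Finset.sum_div]
    refine Finset.sum_le_sum fun i hi => ?_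
    have := not_lt.1 (Finset.mem_filter.1 hi).2
    nlinarith [ha i]
  rcases N.eq_empty_or_nonempty with hNe | hNne
  · refine ⟨Finset.univ, by simp; omega, ?_⟩
    have huniv : P = Finset.univ := by
      ext i
      have : i ∉ N := by simp [hNe]
      simpa [hN, hP] using this
    rw [hNe, Finset.sum_empty] at hsplit
    rw [huniv] at h2 hsplit hP0
    linarith
  · obtain ⟨T, hT, hTc, hle⟩ := exists_subset_card_eq_sum_le β P (P.card / 3) (by omega)
    have hdisj : Disjoint N T := Finset.disjoint_of_subset_right hT
      (Finset.disjoint_filter_filter_not _ _ _)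
    refine ⟨N ∪ T, ?_, ?_⟩
    · rw [Finset.card_union_of_disjoint hdisj, hTc]
      have := hNne.card_pos
      omega
    · rw [Finset.sum_union hdisj]
      have hT3 : ∑ i ∈ T, β i ≤ (∑ i ∈ P, β i) / 3 := by
        rcases Nat.eq_zero_or_pos P.card with h0 | hpos
        · have : T = ∅ := Finset.card_eq_zero.1 (by rw [hTc, h0])
          rw [this, Finset.sum_empty]
          positivity
        · have hpos' : (0 : ℝ) < P.card := by exact_mod_cast hpos
          have h3 : ((P.card / 3 : ℕ) : ℝ) ≤ P.card / 3 := Nat.cast_div_le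
          have h4 := mul_le_mul_of_nonneg_right h3 hP0
          have h5 : (P.card : ℝ) * ∑ i ∈ T, β i ≤ P.card * ((∑ i ∈ P, β i) / 3) := by linarith
          exact le_of_mul_le_mul_left h5 hpos'
      linarith

/-- A matrix with entries summing to zero whose bilinear form takes the value `s` on scalars in
`[-1, 1]` has a submatrix of proportional size whose entries sum to at most `-s / 9`. -/
lemma exists_thirds_sum_le {ι κ : Type*} [Fintype ι] [Fintype κ] [Nonempty ι] [Nonempty κ]
    (B : ι → κ → ℝ) (hB : ∑ i, ∑ j, B i j = 0) {f : ι → ℝ} {g : κ → ℝ}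
    (hf : ∀ i, |f i| ≤ 1) (hg : ∀ j, |g j| ≤ 1) {s : ℝ} (hs0 : 0 ≤ s)
    (hs : s ≤ ∑ i, ∑ j, B i j * (f i * g j)) :
    ∃ (R : Finset ι) (S : Finset κ), Fintype.card ι ≤ 3 * R.card ∧ Fintype.card κ ≤ 3 * S.card ∧
      ∑ i ∈ R, ∑ j ∈ S, B i j ≤ -(s / 9) := by
  have select : ∀ (a : ι → ℝ) (b : κ → ℝ), (∀ i, 1 / 3 ≤ a i) → (∀ i, a i ≤ 1) →
      (∀ j, 1 / 3 ≤ b j) → (∀ j, b j ≤ 1) → ∑ i, ∑ j, B i j * (a i * b j) ≤ -(s / 9) →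
      ∃ (R : Finset ι) (S : Finset κ), Fintype.card ι ≤ 3 * R.card ∧
        Fintype.card κ ≤ 3 * S.card ∧ ∑ i ∈ R, ∑ j ∈ S, B i j ≤ -(s / 9) := by
    intro a b ha ha' hb hb' h
    have e1 : ∑ i, a i * ∑ j, B i j * b j = ∑ i, ∑ j, B i j * (a i * b j) := by
      refine Finset.sum_congr rfl fun i _ => ?_
      rw [Finset.mul_sum]
      exact Finset.sum_congr rfl fun j _ => by ring
    obtain ⟨R, hR, hRs⟩ := exists_third_sum_le (fun i => ∑ j, B i j * b j) a ha ha'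
      (by rw [e1]; linarith)
    have e2 : ∑ j, b j * ∑ i ∈ R, B i j = ∑ i ∈ R, ∑ j, B i j * b j := by
      rw [Finset.sum_comm]
      refine Finset.sum_congr rfl fun j _ => ?_
      rw [Finset.mul_sum]
      exact Finset.sum_congr rfl fun i _ => by ring
    obtain ⟨S, hS, hSs⟩ := exists_third_sum_le (fun j => ∑ i ∈ R, B i j) b hb hb'
      (by rw [e2]; linarith)
    refine ⟨R, S, hR, hS, ?_⟩
    rw [Finset.sum_comm]
    linarith
  -- Weights tilted along `f` and against `g`, or the reverse, are scaled into `[1/3, 1]`; in the sum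
  -- of the two values only the constant and the bilinear terms survive.
  have key : ∑ i, ∑ j, B i j * (2 / 3 * (1 + f i / 2) * (2 / 3 * (1 - g j / 2))) +
      ∑ i, ∑ j, B i j * (2 / 3 * (1 - f i / 2) * (2 / 3 * (1 + g j / 2))) =
      8 / 9 * ∑ i, ∑ j, B i j - 2 / 9 * ∑ i, ∑ j, B i j * (f i * g j) := by
    simp only [Finset.mul_sum, ← Finset.sum_add_distrib, ← Finset.sum_sub_distrib]
    refine Finset.sum_congr rfl fun i _ => Finset.sum_congr rfl fun j _ => ?_
    ring
  rw [hB] at key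
  have f1 := fun i => (abs_le.1 (hf i)).1
  have f2 := fun i => (abs_le.1 (hf i)).2
  have g1 := fun j => (abs_le.1 (hg j)).1
  have g2 := fun j => (abs_le.1 (hg j)).2
  rcases le_or_gt (∑ i, ∑ j, B i j * (2 / 3 * (1 + f i / 2) * (2 / 3 * (1 - g j / 2))))
    (-(s / 9)) with h | h
  · exact select (fun i => 2 / 3 * (1 + f i / 2)) (fun j => 2 / 3 * (1 - g j / 2))
      (fun i => by linarith [f1 i]) (fun i => by linarith [f2 i])
      (fun j => by linarith [g2 j]) (fun j => by linarith [g1 j]) h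
  · exact select (fun i => 2 / 3 * (1 - f i / 2)) (fun j => 2 / 3 * (1 + g j / 2))
      (fun i => by linarith [f2 i]) (fun i => by linarith [f1 i])
      (fun j => by linarith [g1 j]) (fun j => by linarith [g2 j])
      (by linarith)

/-- At least half of the indices carry at most twice the average weight. -/
lemma exists_half_light {ι : Type*} [Fintype ι] (lam : ι → ℝ) (h0 : ∀ i, 0 ≤ lam i) {γ : ℝ}
    (h : ∑ i, lam i ≤ γ) :
    ∃ I : Finset ι, Fintype.card ι ≤ 2 * I.card ∧ ∀ i ∈ I, lam i * Fintype.card ι ≤ 2 * γ := by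
  classical
  set m := Fintype.card ι
  refine ⟨Finset.univ.filter fun i => lam i * m ≤ 2 * γ, ?_, fun i hi => (Finset.mem_filter.1 hi).2⟩
  by_contra! hlt
  set H := Finset.univ.filter fun i => ¬ lam i * m ≤ 2 * γ with hH
  have hcard : (Finset.univ.filter fun i => lam i * m ≤ 2 * γ).card + H.card = m := by
    exact (Finset.card_filter_add_card_filter_not fun i => lam i * m ≤ 2 * γ).trans
      Finset.card_univ
  have hHpos : 0 < H.card := by omega
  have hmH : (m : ℝ) ≤ 2 * H.card := by
    have : m ≤ 2 * H.card := by omega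
    exact_mod_cast this
  have hsum : ∑ _i ∈ H, 2 * γ < ∑ i ∈ H, lam i * m :=
    Finset.sum_lt_sum_of_nonempty (Finset.card_pos.1 hHpos) fun i hi =>
      not_le.1 (Finset.mem_filter.1 hi).2
  rw [Finset.sum_const, nsmul_eq_mul, ← Finset.sum_mul] at hsum
  have hle : ∑ i ∈ H, lam i ≤ γ :=
    (Finset.sum_le_sum_of_subset_of_nonneg (Finset.subset_univ H) fun i _ _ => h0 i).trans h
  have hγ0 : 0 ≤ γ := (Finset.sum_nonneg fun i _ => h0 i).trans h
  have hm0 : (0 : ℝ) ≤ m := by positivity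
  nlinarith [mul_le_mul_of_nonneg_right hle hm0, mul_le_mul_of_nonneg_right hmH hγ0]

/-! ### Consequences of low rank -/

lemma rank_add_vecMulVec_le {ι κ : Type*} [Fintype ι] [Fintype κ] (A : Matrix ι κ ℝ)
    (u : ι → ℝ) (v : κ → ℝ) : (A + Matrix.vecMulVec u v).rank ≤ A.rank + 1 := by
  have h1 := Matrix.rank_vecMulVec_le u v
  unfold Matrix.rank at *
  rw [Matrix.mulVecLin_add]
  calc _ ≤ Module.finrank ℝ
        (LinearMap.range A.mulVecLin ⊔ LinearMap.range (Matrix.vecMulVec u v).mulVecLin :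
          Submodule ℝ (ι → ℝ)) := by
        refine Submodule.finrank_mono ?_
        rintro _ ⟨w, rfl⟩
        exact Submodule.add_mem_sup ⟨w, rfl⟩ ⟨w, rfl⟩
    _ ≤ _ := Submodule.finrank_add_le_finrank_add_finrank _ _
    _ ≤ _ := by omega

lemma rank_sub_const_le {ι κ : Type*} [Fintype ι] [Fintype κ] (A : Matrix ι κ ℝ) (p : ℝ) :
    (Matrix.of fun i j => A i j - p).rank ≤ A.rank + 1 := by
  have h : (Matrix.of fun i j => A i j - p) = A + Matrix.vecMulVec (fun _ => -p) (fun _ => 1) := by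
    ext i j
    simp [Matrix.vecMulVec_apply, sub_eq_add_neg]
  rw [h]
  exact rank_add_vecMulVec_le _ _ _

/-- The squared Frobenius norm is at most the rank times the squared operator norm; the bound on
the operator norm enters in an additive form. -/
lemma sum_sq_le_rank_mul {ι κ : Type*} [Fintype ι] [Fintype κ] (A : Matrix ι κ ℝ) {a b : ℝ}
    (hb : 0 ≤ b)
    (h : ∀ (f : ι → ℝ) (g : κ → ℝ), ∑ i, ∑ j, A i j * (f i * g j) ≤
      (a * ∑ i, f i ^ 2 + b * ∑ j, g j ^ 2) / 2) :
    ∑ i, ∑ j, A i j ^ 2 ≤ A.rank * (a * b) := by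
  classical
  set col : κ → EuclideanSpace ℝ ι := fun j => WithLp.toLp 2 fun i => A i j with hcol
  set W := Submodule.span ℝ (Set.range col) with hW
  have hrank : Module.finrank ℝ W = A.rank := by
    rw [Matrix.rank_eq_finrank_span_cols]
    have e : W = (Submodule.span ℝ (Set.range A.col)).map
        ((WithLp.linearEquiv 2 ℝ (ι → ℝ)).symm : (ι → ℝ) →ₗ[ℝ] EuclideanSpace ℝ ι) := by
      rw [Submodule.map_span, ← Set.range_comp]
      rfl
    rw [e]
    exact LinearEquiv.finrank_map_eq _ _
  let v := stdOrthonormalBasis ℝ W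
  have hv : ∀ k, ∑ j, inner ℝ (v k : EuclideanSpace ℝ ι) (col j) ^ 2 ≤ a * b := by
    intro k
    set w : EuclideanSpace ℝ ι := ((v k : W) : EuclideanSpace ℝ ι) with hw
    have hw1 : ∑ i, w i ^ 2 = 1 := by
      rw [← EuclideanSpace.real_norm_sq_eq]
      have : ‖w‖ = 1 := v.orthonormal.1 k
      rw [this, one_pow]
    have hin : ∀ j, inner ℝ w (col j) = ∑ i, A i j * w i := by
      intro j
      simp [PiLp.inner_apply, hcol]
    set s := ∑ j, inner ℝ w (col j) ^ 2 with hs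
    have hs0 : 0 ≤ s := Finset.sum_nonneg fun j _ => sq_nonneg _
    have hu : ∀ u : ℝ, u * s ≤ (a + b * (u ^ 2 * s)) / 2 := by
      intro u
      have := h w fun j => u * inner ℝ w (col j)
      have e1 : ∑ i, ∑ j, A i j * (w i * (u * inner ℝ w (col j))) = u * s := by
        rw [Finset.sum_comm, hs, Finset.mul_sum]
        refine Finset.sum_congr rfl fun j _ => ?_
        calc _ = (∑ i, A i j * w i) * (u * inner ℝ w (col j)) := by
              rw [Finset.sum_mul]
              exact Finset.sum_congr rfl fun i _ => by ring
          _ = _ := by rw [← hin]; ring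
      rw [e1, hw1] at this
      simpa only [mul_pow, ← Finset.mul_sum, mul_one] using this
    rcases hb.eq_or_lt with rfl | hbpos
    · by_contra! hlt
      simp only [mul_zero] at hlt
      have := hu ((a + 1) / s)
      rw [div_mul_cancel₀ _ hlt.ne'] at this
      have h0 := hu 0
      simp only [zero_mul] at this h0
      linarith
    · have := hu (1 / b)
      have e : (a + b * ((1 / b) ^ 2 * s)) / 2 = (a + s / b) / 2 := by
        field_simp
      rw [e, one_div, inv_mul_eq_div] at this
      have h2 : s / b ≤ a := by linarith
      rwa [div_le_iff₀ hbpos] at h2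
  have hcolsq : ∀ j, ∑ i, A i j ^ 2 = ∑ k, inner ℝ (v k : EuclideanSpace ℝ ι) (col j) ^ 2 := by
    intro j
    have hmem : col j ∈ W := Submodule.subset_span ⟨j, rfl⟩
    have := v.sum_sq_norm_inner_right ⟨col j, hmem⟩
    simp only [Submodule.coe_inner, Submodule.coe_norm, Real.norm_eq_abs, sq_abs] at this
    rw [this, EuclideanSpace.real_norm_sq_eq]
  calc ∑ i, ∑ j, A i j ^ 2
      = ∑ k, ∑ j, inner ℝ (v k : EuclideanSpace ℝ ι) (col j) ^ 2 := by
        rw [Finset.sum_comm (s := (Finset.univ : Finset ι)),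
          Finset.sum_comm (t := (Finset.univ : Finset κ))]
        exact Finset.sum_congr rfl fun j _ => hcolsq j
    _ ≤ ∑ _k : Fin (Module.finrank ℝ W), a * b := Finset.sum_le_sum fun k _ => hv k
    _ = _ := by simp [hrank]

/-- Some set of at most `A.rank` columns, namely a basis of the column space, detects zero rows. -/
lemma exists_card_le_rank_of_columns {ι κ : Type*} [Fintype ι] [Fintype κ] (A : Matrix ι κ ℝ) :
    ∃ T : Finset κ, T.card ≤ A.rank ∧ ∀ i, (∀ j ∈ T, A i j = 0) → ∀ j, A i j = 0 := by
  classical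
  obtain ⟨f, hf, hspan, -⟩ := Submodule.exists_fun_fin_finrank_span_eq ℝ (Set.range A.col)
  choose c hc using hf
  refine ⟨Finset.univ.image c, ?_, fun i hi j => ?_⟩
  · rw [Matrix.rank_eq_finrank_span_cols]
    exact Finset.card_image_le.trans (by simp)
  · have hker : Submodule.span ℝ (Set.range f) ≤
        LinearMap.ker (LinearMap.proj i : (ι → ℝ) →ₗ[ℝ] ℝ) := by
      rw [Submodule.span_le]
      rintro _ ⟨l, rfl⟩
      have := hi (c l) (Finset.mem_image_of_mem c (Finset.mem_univ l))
      rw [← hc l]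
      simpa using this
    rw [hspan] at hker
    have := hker (Submodule.subset_span (Set.mem_range_self j))
    simpa using this

/-- If the nonzero entries of a matrix of rank at most `D` have density at most `1 / (8 D)`, then it
has a zero submatrix on half of the rows and columns. Half of the columns are sparse; a basis of
their span consists of at most `D` sparse columns, whose supports miss most of the rows. -/
lemma exists_zero_submatrix_of_sparse {ι κ : Type*} [Fintype ι] [Fintype κ] [Nonempty ι]
    (A : Matrix ι κ ℝ) {D : ℕ} (hD : A.rank ≤ D)
    (hsparse : 8 * D * (∑ i, ∑ j, if A i j = 0 then (0 : ℝ) else 1) ≤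
      Fintype.card ι * Fintype.card κ) :
    ∃ (R : Finset ι) (S : Finset κ), Fintype.card ι ≤ 2 * R.card ∧ Fintype.card κ ≤ 2 * S.card ∧
      ∀ i ∈ R, ∀ j ∈ S, A i j = 0 := by
  classical
  set m := Fintype.card ι with hm
  set nz : κ → ℝ := fun j => ∑ i, if A i j = 0 then (0 : ℝ) else 1 with hnz
  obtain ⟨S, hS, hSl⟩ := exists_half_light nz
    (fun j => Finset.sum_nonneg fun i _ => by split_ifs <;> norm_num) le_rfl
  rw [Finset.sum_comm] at hsparse
  set n := Fintype.card κ with hn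
  rcases Nat.eq_zero_or_pos n with hn0 | hnpos
  · exact ⟨Finset.univ, ∅, by simp; omega, by simp [hn0], by simp⟩
  have hn' : (0 : ℝ) < n := by exact_mod_cast hnpos
  have hlight : ∀ j ∈ S, 4 * D * nz j ≤ m := by
    intro j hj
    have h1 := hSl j hj
    have h2 : n * (4 * D * nz j) ≤ n * m := by
      have h3 : (0 : ℝ) ≤ 4 * D := by positivity
      nlinarith [mul_le_mul_of_nonneg_left h1 h3]
    exact le_of_mul_le_mul_left h2 hn'
  set A' : Matrix ι S ℝ := A.submatrix id (fun j : S => (j : κ)) with hA'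
  obtain ⟨T, hTc, hT⟩ := exists_card_le_rank_of_columns A'
  have hTD : T.card ≤ D := hTc.trans ((Matrix.rank_submatrix_le A _ _).trans hD)
  set R := Finset.univ.filter fun i => ∀ j ∈ T, A' i j = 0 with hR
  refine ⟨R, S, ?_, hS, fun i hi j hj => hT i (Finset.mem_filter.1 hi).2 ⟨j, hj⟩⟩
  -- Each row outside `R` is hit by the support of one of the columns in `T`.
  have hbad : ((Finset.univ.filter fun i => ¬ ∀ j ∈ T, A' i j = 0).card : ℝ)
      ≤ ∑ j ∈ T, nz j := by
    have : ∑ j ∈ T, nz j = ∑ i, ∑ j ∈ T, if A' i j = 0 then (0 : ℝ) else 1 := by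
      rw [Finset.sum_comm]
      rfl
    rw [this, Finset.card_filter, Nat.cast_sum]
    refine Finset.sum_le_sum fun i _ => ?_
    have nonneg : ∀ j ∈ T, (0 : ℝ) ≤ if A' i j = 0 then (0 : ℝ) else 1 := fun j _ => by
      split_ifs <;> norm_num
    by_cases hi : ∀ j ∈ T, A' i j = 0
    · rw [if_neg (not_not.2 hi), Nat.cast_zero]
      exact Finset.sum_nonneg nonneg
    · rw [if_pos hi, Nat.cast_one]
      push Not at hi
      obtain ⟨j, hj, hij⟩ := hi
      refine le_trans ?_ (Finset.single_le_sum nonneg hj)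
      simp [hij]
  have hsum : 4 * D * ∑ j ∈ T, nz j ≤ D * m := by
    rw [Finset.mul_sum]
    calc _ ≤ ∑ _j ∈ T, (m : ℝ) := Finset.sum_le_sum fun j _ => hlight j j.2
      _ = T.card * m := by simp
      _ ≤ D * m := by gcongr
  have hcard : R.card + (Finset.univ.filter fun i => ¬ ∀ j ∈ T, A' i j = 0).card = m := by
    exact (Finset.card_filter_add_card_filter_not fun i => ∀ j ∈ T, A' i j = 0).trans
      Finset.card_univ
  set b := (Finset.univ.filter fun i => ¬ ∀ j ∈ T, A' i j = 0).card with hb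
  rcases Nat.eq_zero_or_pos D with h0 | hpos
  · have : T = ∅ := Finset.card_eq_zero.1 (by omega)
    have hb0 : b = 0 := by simp [hb, this]
    omega
  · have hD0 : (0 : ℝ) < D := by exact_mod_cast hpos
    have : (D : ℝ) * (4 * b) ≤ D * m := by nlinarith
    have h4 : (4 * b : ℝ) ≤ m := le_of_mul_le_mul_left this hD0
    have : 4 * b ≤ m := by exact_mod_cast h4
    omega

/-! ### One step: a dense constant submatrix or a drop of the average -/

lemma abs_natCast_sub_le_sq (a k : ℕ) : |(a : ℝ) - k| ≤ ((a : ℝ) - k) ^ 2 := by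
  have h : |(a : ℤ) - k| ≤ ((a : ℤ) - k) ^ 2 := by
    rw [← sq_abs]
    exact Int.le_self_sq _
  exact_mod_cast h

/-- If `k` is a nearest integer to `p`, then no natural number is much closer to `p` than to `k`,
so that the integrality of `a` turns the square into a first power. -/
lemma abs_natCast_sub_le_four_mul_sq {a k : ℕ} {p : ℝ} (hp : |p - k| ≤ 1 / 2) :
    |(a : ℝ) - k| ≤ 4 * ((a : ℝ) - p) ^ 2 := by
  rcases eq_or_ne a k with rfl | hne
  · simpa using sq_nonneg _
  · have h1 : 1 ≤ |(a : ℝ) - k| := by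
      have : (1 : ℤ) ≤ |(a : ℤ) - k| := Int.one_le_abs (sub_ne_zero.2 (by exact_mod_cast hne))
      exact_mod_cast this
    have h2 : |(a : ℝ) - k| ≤ |(a : ℝ) - p| + |p - k| := abs_sub_le _ _ _
    have h3 : |(a : ℝ) - k| ≤ 2 * |(a : ℝ) - p| := by linarith
    have h4 := abs_natCast_sub_le_sq a k
    rw [← sq_abs] at h4
    rw [← sq_abs ((a : ℝ) - p)]
    nlinarith [abs_nonneg ((a : ℝ) - p)]

/-- A submatrix of a matrix of naturals whose entries have mean distance at most `1 / (8 D)` from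
`k` contains a submatrix with all entries equal to `k`. -/
lemma exists_const_submatrix_of_near_const {ι κ : Type*} [Fintype ι] [Fintype κ]
    (M : Matrix ι κ ℕ) {D : ℕ} (hD : (M.map (Nat.cast : ℕ → ℝ)).rank + 1 ≤ D) (k : ℕ)
    (I : Finset ι) (J : Finset κ) (hI : I.Nonempty)
    (h : 8 * D * (∑ i ∈ I, ∑ j ∈ J, |(M i j : ℝ) - k|) ≤ I.card * J.card) :
    ∃ (R : Finset ι) (S : Finset κ), I.card ≤ 2 * R.card ∧ J.card ≤ 2 * S.card ∧
      ∀ i ∈ R, ∀ j ∈ S, M i j = k := by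
  classical
  have : Nonempty I := hI.to_subtype
  let A : Matrix I J ℝ :=
    (Matrix.of fun i j => M.map (Nat.cast : ℕ → ℝ) i j - (k : ℝ)).submatrix Subtype.val Subtype.val
  have hA : A.rank ≤ D :=
    (Matrix.rank_submatrix_le _ _ _).trans ((rank_sub_const_le _ _).trans hD)
  have hle : (∑ i, ∑ j, if A i j = 0 then (0 : ℝ) else 1) ≤
      ∑ i ∈ I, ∑ j ∈ J, |(M i j : ℝ) - k| := by
    rw [← Finset.sum_coe_sort I]
    refine Finset.sum_le_sum fun i _ => ?_
    rw [← Finset.sum_coe_sort J]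
    refine Finset.sum_le_sum fun j _ => ?_
    have e : A i j = (M i j : ℝ) - k := rfl
    rw [e]
    split_ifs with h0
    · exact abs_nonneg _
    · have hne : (M i j : ℤ) - k ≠ 0 := fun h => h0 (by exact_mod_cast h)
      exact_mod_cast Int.one_le_abs hne
  obtain ⟨R, S, hR, hS, hRS⟩ := exists_zero_submatrix_of_sparse A hA (by
    simp only [Fintype.card_coe]
    exact (mul_le_mul_of_nonneg_left hle (by positivity)).trans h)
  simp only [Fintype.card_coe] at hR hS
  refine ⟨R.map (Function.Embedding.subtype _), S.map (Function.Embedding.subtype _),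
    by simpa using hR, by simpa using hS, ?_⟩
  intro i hi j hj
  obtain ⟨i, hi', rfl⟩ := Finset.mem_map.1 hi
  obtain ⟨j, hj', rfl⟩ := Finset.mem_map.1 hj
  have : (M i j : ℝ) - k = 0 := hRS i hi' j hj'
  exact_mod_cast sub_eq_zero.1 this

/-- Restricting a dominated form to light rows and columns bounds its operator norm, and the rank
then bounds its squared entries. -/
lemma exists_light_submatrix {ι κ : Type*} [Fintype ι] [Fintype κ] [Nonempty ι] [Nonempty κ]
    (B : Matrix ι κ ℝ) {D : ℕ} (hD : B.rank ≤ D) {lam : ι → ℝ} {mu : κ → ℝ} {γ : ℝ}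
    (hlam0 : ∀ i, 0 ≤ lam i) (hmu0 : ∀ j, 0 ≤ mu j)
    (hlam : ∑ i, lam i = γ) (hmu : ∑ j, mu j = γ)
    (hdom : ∀ (f : ι → ℝ) (g : κ → ℝ), ∑ i, ∑ j, B i j * (f i * g j) ≤
      (∑ i, lam i * f i ^ 2 + ∑ j, mu j * g j ^ 2) / 2) :
    ∃ (I : Finset ι) (J : Finset κ), Fintype.card ι ≤ 2 * I.card ∧ Fintype.card κ ≤ 2 * J.card ∧
      ∑ i ∈ I, ∑ j ∈ J, B i j ^ 2 ≤
        D * (2 * γ / Fintype.card ι * (2 * γ / Fintype.card κ)) ∧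
      |∑ i ∈ I, ∑ j ∈ J, B i j| ≤ γ := by
  classical
  obtain ⟨I, hI, hIl⟩ := exists_half_light lam hlam0 hlam.le
  obtain ⟨J, hJ, hJl⟩ := exists_half_light mu hmu0 hmu.le
  have hγ0 : 0 ≤ γ := hlam ▸ Finset.sum_nonneg fun i _ => hlam0 i
  have hm : (0 : ℝ) < Fintype.card ι := by exact_mod_cast Fintype.card_pos
  have hn : (0 : ℝ) < Fintype.card κ := by exact_mod_cast Fintype.card_pos
  refine ⟨I, J, hI, hJ, ?_, ?_⟩
  · let A : Matrix I J ℝ := B.submatrix Subtype.val Subtype.val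
    have h := sum_sq_le_rank_mul A (a := 2 * γ / Fintype.card ι) (b := 2 * γ / Fintype.card κ)
      (by positivity) (fun f g => by
        have := hdom (fun i => if h : i ∈ I then f ⟨i, h⟩ else 0)
          (fun j => if h : j ∈ J then g ⟨j, h⟩ else 0)
        have e1 : ∑ i, ∑ j, B i j * ((if h : i ∈ I then f ⟨i, h⟩ else 0) *
            (if h : j ∈ J then g ⟨j, h⟩ else 0)) = ∑ i, ∑ j, A i j * (f i * g j) := by
          rw [← Finset.sum_subset (Finset.subset_univ I), ← Finset.sum_coe_sort I]
          · refine Finset.sum_congr rfl fun i _ => ?_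
            rw [← Finset.sum_subset (Finset.subset_univ J), ← Finset.sum_coe_sort J]
            · refine Finset.sum_congr rfl fun j _ => ?_
              simp [A]
            · intro j _ hj
              simp [hj]
          · intro i _ hi
            simp [hi]
        have e2 : ∑ i, lam i * (if h : i ∈ I then f ⟨i, h⟩ else 0) ^ 2 ≤
            2 * γ / Fintype.card ι * ∑ i, f i ^ 2 := by
          rw [← Finset.sum_subset (Finset.subset_univ I), ← Finset.sum_coe_sort I, Finset.mul_sum]
          · refine Finset.sum_le_sum fun i _ => ?_
            simp only [Finset.coe_mem, dite_true, Subtype.coe_eta]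
            refine mul_le_mul_of_nonneg_right ?_ (sq_nonneg _)
            rw [le_div_iff₀ hm]
            exact hIl i i.2
          · intro i _ hi
            simp [hi]
        have e3 : ∑ j, mu j * (if h : j ∈ J then g ⟨j, h⟩ else 0) ^ 2 ≤
            2 * γ / Fintype.card κ * ∑ j, g j ^ 2 := by
          rw [← Finset.sum_subset (Finset.subset_univ J), ← Finset.sum_coe_sort J, Finset.mul_sum]
          · refine Finset.sum_le_sum fun j _ => ?_
            simp only [Finset.coe_mem, dite_true, Subtype.coe_eta]
            refine mul_le_mul_of_nonneg_right ?_ (sq_nonneg _)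
            rw [le_div_iff₀ hn]
            exact hJl j j.2
          · intro j _ hj
            simp [hj]
        rw [← e1]
        linarith)
    have e : ∑ i, ∑ j, A i j ^ 2 = ∑ i ∈ I, ∑ j ∈ J, B i j ^ 2 := by
      rw [← Finset.sum_coe_sort I]
      refine Finset.sum_congr rfl fun i _ => ?_
      rw [← Finset.sum_coe_sort J]
      rfl
    rw [e] at h
    refine h.trans (mul_le_mul_of_nonneg_right ?_ (by positivity))
    exact_mod_cast (Matrix.rank_submatrix_le B _ _).trans hD
  · have bound : ∀ s : ℝ, s ^ 2 = 1 → s * ∑ i ∈ I, ∑ j ∈ J, B i j ≤ γ := by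
      intro s hs
      have := hdom (fun i => if i ∈ I then s else 0) (fun j => if j ∈ J then 1 else 0)
      have e1 : ∑ i, ∑ j, B i j * ((if i ∈ I then s else 0) * (if j ∈ J then (1 : ℝ) else 0)) =
          s * ∑ i ∈ I, ∑ j ∈ J, B i j := by
        simp [Finset.sum_ite_mem, ← Finset.sum_mul, mul_comm s]
      have e2 : ∑ i, lam i * (if i ∈ I then s else 0) ^ 2 ≤ ∑ i, lam i :=
        Finset.sum_le_sum fun i _ => by split_ifs <;> simp [hs, hlam0 i]
      have e3 : ∑ j, mu j * (if j ∈ J then (1 : ℝ) else 0) ^ 2 ≤ ∑ j, mu j :=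
        Finset.sum_le_sum fun j _ => by split_ifs <;> simp [hmu0 j]
      rw [e1] at this
      rw [hlam] at e2
      rw [hmu] at e3
      linarith
    rw [abs_le]
    constructor
    · linarith [bound (-1) (by norm_num)]
    · linarith [bound 1 (by norm_num)]

/-- One step of the iteration: for a matrix of naturals with average `p` and `k` a nearest integer
to `p`, there is a large submatrix with all entries `k`, or the average drops by some `δ` on a
submatrix of proportional size, where `δ` is at least of order `1 / D` and of order
`√(|p - k| / D)`. -/
theorem exists_const_submatrix_or_average_drop {ι κ : Type*} [Fintype ι] [Fintype κ]
    [Nonempty ι] [Nonempty κ] (M : Matrix ι κ ℕ) {D : ℕ}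
    (hD : (M.map (Nat.cast : ℕ → ℝ)).rank + 1 ≤ D) {p : ℝ} {k : ℕ}
    (hp : ∑ i, ∑ j, (M i j : ℝ) = p * (Fintype.card ι * Fintype.card κ))
    (hk : |p - k| ≤ 1 / 2) :
    (∃ (R : Finset ι) (S : Finset κ), Fintype.card ι ≤ 4 * R.card ∧
      Fintype.card κ ≤ 4 * S.card ∧ ∀ i ∈ R, ∀ j ∈ S, M i j = k) ∨
    ∃ (R : Finset ι) (S : Finset κ) (δ : ℝ), Fintype.card ι ≤ 3 * R.card ∧
      Fintype.card κ ≤ 3 * S.card ∧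
      ∑ i ∈ R, ∑ j ∈ S, (M i j : ℝ) ≤ (p - δ) * (R.card * S.card) ∧
      0 < δ ∧ 1 ≤ 2000 * D * δ ∧ |p - k| ≤ 2000 ^ 2 * D * δ ^ 2 := by
  classical
  have hm : (0 : ℝ) < Fintype.card ι := by exact_mod_cast Fintype.card_pos
  have hn : (0 : ℝ) < Fintype.card κ := by exact_mod_cast Fintype.card_pos
  let B : Matrix ι κ ℝ := Matrix.of fun i j => M.map (Nat.cast : ℕ → ℝ) i j - p
  have hBe : ∀ i j, B i j = (M i j : ℝ) - p := fun i j => rfl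
  have hBr : B.rank ≤ D := (rank_sub_const_le _ _).trans hD
  have hB0 : ∑ i, ∑ j, B i j = 0 := by
    simp only [hBe, Finset.sum_sub_distrib, Finset.sum_const, Finset.card_univ, nsmul_eq_mul, hp]
    ring
  obtain ⟨lam, mu, γ, hlam0, hmu0, hlam, hmu, hdom, f, g, hf, hg, hfg⟩ :=
    exists_dominating_weights B
  have hγ0 : 0 ≤ γ := hlam ▸ Finset.sum_nonneg fun i _ => hlam0 i
  obtain ⟨I, J, hI, hJ, hsq, habs⟩ := exists_light_submatrix B hBr hlam0 hmu0 hlam hmu hdom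
  have hI' : (Fintype.card ι : ℝ) ≤ 2 * I.card := by exact_mod_cast hI
  have hJ' : (Fintype.card κ : ℝ) ≤ 2 * J.card := by exact_mod_cast hJ
  set m : ℝ := (Fintype.card ι : ℝ) with hmdef
  set n : ℝ := (Fintype.card κ : ℝ) with hndef
  set η : ℝ := γ / (m * n) with hη
  have hη0 : 0 ≤ η := by positivity
  have hγη : γ = η * (m * n) := by rw [hη]; field_simp
  have hIpos : (0 : ℝ) < I.card := by linarith
  have hJpos : (0 : ℝ) < J.card := by linarith
  have hmn : m * n ≤ 4 * (I.card * J.card) := by nlinarith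
  have hD0 : (1 : ℝ) ≤ D := by exact_mod_cast (by omega : 1 ≤ D)
  set s : ℝ := I.card * J.card with hs
  have hspos : 0 < s := mul_pos hIpos hJpos
  -- The entries on the light part have mean distance at most `64 D η ^ 2` from `k`.
  have hdist : ∑ i ∈ I, ∑ j ∈ J, |(M i j : ℝ) - k| ≤ 64 * D * η ^ 2 * s := by
    calc _ ≤ ∑ i ∈ I, ∑ j ∈ J, 4 * B i j ^ 2 :=
          Finset.sum_le_sum fun i _ => Finset.sum_le_sum fun j _ =>
            abs_natCast_sub_le_four_mul_sq hk
      _ = 4 * ∑ i ∈ I, ∑ j ∈ J, B i j ^ 2 := by simp only [Finset.mul_sum]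
      _ ≤ 4 * (D * (2 * γ / m * (2 * γ / n))) := by linarith
      _ = 16 * D * η ^ 2 * (m * n) := by rw [hγη]; field_simp; ring
      _ ≤ 16 * D * η ^ 2 * (4 * s) := by gcongr
      _ = _ := by ring
  rcases le_or_gt (8 * D * (64 * D * η ^ 2)) 1 with hsmall | hlarge
  · left
    obtain ⟨R, S, hR, hS, hRS⟩ := exists_const_submatrix_of_near_const M hD k I J
      (Finset.card_pos.1 (by exact_mod_cast hIpos)) (by
        calc _ ≤ 8 * D * (64 * D * η ^ 2 * s) := by gcongr
          _ = 8 * D * (64 * D * η ^ 2) * s := by ring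
          _ ≤ 1 * s := mul_le_mul_of_nonneg_right hsmall hspos.le
          _ = _ := one_mul _)
    exact ⟨R, S, by omega, by omega, hRS⟩
  · right
    obtain ⟨R, S, hR, hS, hRS⟩ := exists_thirds_sum_le B hB0 hf hg (by positivity) hfg
    have hDη : 1 < 23 * (D * η) := by
      by_contra! hcon
      have h0 : 0 ≤ D * η := by positivity
      nlinarith
    have hηpos : 0 < η := by
      rcases hη0.eq_or_lt with h | h
      · rw [← h] at hDη
        norm_num at hDη
      · exact h
    -- The mean distance from `k` and the small change of the average bound `|p - k|`.
    have hpk : |p - k| ≤ 4 * η + 64 * D * η ^ 2 := by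
      have e : (p - k) * s = ∑ i ∈ I, ∑ j ∈ J, ((M i j : ℝ) - k) - ∑ i ∈ I, ∑ j ∈ J, B i j := by
        simp only [hBe, ← Finset.sum_sub_distrib]
        simp only [sub_sub_sub_cancel_left, Finset.sum_const, nsmul_eq_mul, hs]
        ring
      have h1 : |∑ i ∈ I, ∑ j ∈ J, ((M i j : ℝ) - k)| ≤ ∑ i ∈ I, ∑ j ∈ J, |(M i j : ℝ) - k| :=
        (Finset.abs_sum_le_sum_abs _ _).trans
          (Finset.sum_le_sum fun i _ => Finset.abs_sum_le_sum_abs _ _)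
      have h2 : |p - k| * s ≤ (4 * η + 64 * D * η ^ 2) * s := by
        calc |p - k| * s = |(p - k) * s| := by rw [abs_mul, abs_of_pos hspos]
          _ ≤ 64 * D * η ^ 2 * s + γ := by
            rw [e]
            refine (abs_sub _ _).trans ?_
            linarith
          _ ≤ 64 * D * η ^ 2 * s + η * (4 * s) := by
            rw [hγη]
            gcongr
          _ = _ := by ring
      exact le_of_mul_le_mul_right h2 hspos
    refine ⟨R, S, η / 72, hR, hS, ?_, by positivity, by nlinarith, ?_⟩
    · have e : ∑ i ∈ R, ∑ j ∈ S, B i j = ∑ i ∈ R, ∑ j ∈ S, (M i j : ℝ) - p * (R.card * S.card) := by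
        simp only [hBe, Finset.sum_sub_distrib, Finset.sum_const, nsmul_eq_mul]
        ring
      have hRm : (R.card : ℝ) ≤ m := Nat.cast_le.2 R.card_le_univ
      have hSn : (S.card : ℝ) ≤ n := Nat.cast_le.2 S.card_le_univ
      have hle : (R.card : ℝ) * S.card ≤ m * n :=
        mul_le_mul hRm hSn (Nat.cast_nonneg _) hm.le
      rw [e] at hRS
      have : η * (R.card * S.card) ≤ γ := by
        rw [hγη]
        exact mul_le_mul_of_nonneg_left hle hη0
      linarith
    · have h1 : 4 * η ≤ 92 * (D * η ^ 2) := by nlinarith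
      have h2 : 0 ≤ D * η ^ 2 := by positivity
      have h3 : 2000 ^ 2 * D * (η / 72) ^ 2 = 2000 ^ 2 / 72 ^ 2 * (D * η ^ 2) := by ring
      rw [h3]
      linarith

/-! ### Iteration -/

/-- The matrix `M` has a constant submatrix on at least a `1 / (4 * 3 ^ N)` fraction of the rows and
of the columns. -/
def HasConstSubmatrix {ι κ : Type*} [Fintype ι] [Fintype κ] (M : Matrix ι κ ℕ) (N : ℕ) : Prop :=
  ∃ (R : Finset ι) (S : Finset κ), (∃ k : ℕ, ∀ i ∈ R, ∀ j ∈ S, M i j = k) ∧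
    Fintype.card ι ≤ 4 * 3 ^ N * R.card ∧ Fintype.card κ ≤ 4 * 3 ^ N * S.card

lemma HasConstSubmatrix.mono {ι κ : Type*} [Fintype ι] [Fintype κ] {M : Matrix ι κ ℕ} {N N' : ℕ}
    (h : HasConstSubmatrix M N) (hN : N ≤ N') : HasConstSubmatrix M N' := by
  obtain ⟨R, S, hc, hR, hS⟩ := h
  have : 3 ^ N ≤ 3 ^ N' := Nat.pow_le_pow_right (by norm_num) hN
  exact ⟨R, S, hc, hR.trans (by gcongr), hS.trans (by gcongr)⟩

lemma HasConstSubmatrix.of_submatrix {ι κ : Type*} [Fintype ι] [Fintype κ] {M : Matrix ι κ ℕ}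
    {N : ℕ} {R : Finset ι} {S : Finset κ} (hR : Fintype.card ι ≤ 3 * R.card)
    (hS : Fintype.card κ ≤ 3 * S.card)
    (h : HasConstSubmatrix (M.submatrix (Subtype.val : R → ι) (Subtype.val : S → κ)) N) :
    HasConstSubmatrix M (N + 1) := by
  obtain ⟨R', S', ⟨k, hk⟩, hR', hS'⟩ := h
  rw [Fintype.card_coe] at hR' hS'
  refine ⟨R'.map (Function.Embedding.subtype _), S'.map (Function.Embedding.subtype _),
    ⟨k, ?_⟩, ?_, ?_⟩
  · intro i hi j hj
    obtain ⟨i, hi', rfl⟩ := Finset.mem_map.1 hi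
    obtain ⟨j, hj', rfl⟩ := Finset.mem_map.1 hj
    exact hk i hi' j hj'
  · rw [Finset.card_map, pow_succ]
    linarith
  · rw [Finset.card_map, pow_succ]
    linarith

/-- Every matrix of naturals of rank less than `D` and average at most `x` has a constant submatrix
of density `1 / (4 * 3 ^ N)`. Quantifying over all finite index types allows passing to
submatrices. -/
def ConstSubmatrixBound (D : ℕ) (x : ℝ) (N : ℕ) : Prop :=
  ∀ (ι κ : Type) [Fintype ι] [Fintype κ] [Nonempty ι] [Nonempty κ] (M : Matrix ι κ ℕ),
    (M.map (Nat.cast : ℕ → ℝ)).rank + 1 ≤ D →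
    ∑ i, ∑ j, (M i j : ℝ) ≤ x * (Fintype.card ι * Fintype.card κ) → HasConstSubmatrix M N

/-- If every drop guaranteed by the single step at an average in `[x', x]` leads below `x'`, then the
threshold can be raised from `x'` to `x` at the cost of one step. -/
lemma ConstSubmatrixBound.step {D N k : ℕ} {x x' : ℝ} (h : ConstSubmatrixBound D x' N)
    (hx : x ≤ k + 1 / 2) (hx' : k - 1 / 2 ≤ x')
    (hdrop : ∀ p δ : ℝ, x' ≤ p → p ≤ x → 0 < δ → 1 ≤ 2000 * D * δ →
      |p - k| ≤ 2000 ^ 2 * D * δ ^ 2 → x - x' ≤ δ) :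
    ConstSubmatrixBound D x (N + 1) := by
  intro ι κ _ _ _ _ M hD hM
  have hm : (0 : ℝ) < Fintype.card ι := by exact_mod_cast Fintype.card_pos
  have hn : (0 : ℝ) < Fintype.card κ := by exact_mod_cast Fintype.card_pos
  have hmn : (0 : ℝ) < Fintype.card ι * Fintype.card κ := mul_pos hm hn
  set p : ℝ := (∑ i, ∑ j, (M i j : ℝ)) / (Fintype.card ι * Fintype.card κ) with hp
  have hpM : ∑ i, ∑ j, (M i j : ℝ) = p * (Fintype.card ι * Fintype.card κ) := by
    rw [hp, div_mul_cancel₀ _ hmn.ne']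
  have hpx : p ≤ x := (div_le_iff₀ hmn).2 hM
  rcases le_or_gt p x' with hle | hgt
  · exact (h ι κ M hD (by rw [hpM]; gcongr)).mono N.le_succ
  rcases exists_const_submatrix_or_average_drop M hD hpM (k := k)
    (abs_le.2 ⟨by linarith, by linarith⟩) with ⟨R, S, hR, hS, hRS⟩ | ⟨R, S, δ, hR, hS, hs, h0, h1, h2⟩
  · have h3 : 1 ≤ 3 ^ (N + 1) := Nat.one_le_pow _ _ (by norm_num)
    exact ⟨R, S, ⟨k, hRS⟩, hR.trans (by nlinarith), hS.trans (by nlinarith)⟩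
  · have hδ := hdrop p δ hgt.le hpx h0 h1 h2
    have hRne : R.Nonempty := Finset.card_pos.1 (by have := Fintype.card_pos (α := ι); omega)
    have hSne : S.Nonempty := Finset.card_pos.1 (by have := Fintype.card_pos (α := κ); omega)
    have := hRne.to_subtype
    have := hSne.to_subtype
    refine .of_submatrix hR hS (h R S _ ?_ ?_)
    · rw [← Matrix.submatrix_map]
      exact (Nat.add_le_add_right (Matrix.rank_submatrix_le _ _ _) 1).trans hD
    · have e : ∑ i : R, ∑ j : S, ((M.submatrix Subtype.val Subtype.val i j : ℕ) : ℝ) =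
          ∑ i ∈ R, ∑ j ∈ S, (M i j : ℝ) := by
        rw [← Finset.sum_coe_sort R]
        refine Finset.sum_congr rfl fun i _ => ?_
        rw [← Finset.sum_coe_sort S]
        rfl
      rw [e, Fintype.card_coe, Fintype.card_coe]
      exact hs.trans (mul_le_mul_of_nonneg_right (by linarith)
        (mul_nonneg (Nat.cast_nonneg _) (Nat.cast_nonneg _)))

/-- Consecutive points of the grid `j |j| / (2 q ^ 2)` around an integer are closer than the
guaranteed drop. The quadratic grid is adapted to a drop of order `√d` at distance `d`. -/
lemma grid_gap_le_drop {D q : ℕ} (hq : 0 < q) (hqD : 8000 ^ 2 * D ≤ q ^ 2) {μ d δ : ℝ} (hμ : 0 ≤ μ)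
    (hd : μ ^ 2 / (2 * q ^ 2) ≤ d) (hδ : 0 < δ) (h1 : 1 ≤ 2000 * D * δ)
    (h2 : d ≤ 2000 ^ 2 * D * δ ^ 2) : (2 * μ + 1) / (2 * q ^ 2) ≤ δ := by
  have hq' : (0 : ℝ) < q := by exact_mod_cast hq
  have hqD' : (8000 : ℝ) ^ 2 * D ≤ q ^ 2 := by exact_mod_cast hqD
  have h3 : 1 ≤ δ * q ^ 2 := by nlinarith
  have h4 : μ ^ 2 ≤ (q ^ 2 * δ / 2) ^ 2 := by
    have h5 : μ ^ 2 ≤ 2000 ^ 2 * D * δ ^ 2 * (2 * q ^ 2) :=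
      (div_le_iff₀ (by positivity)).1 (hd.trans h2)
    have h6 : (8000 : ℝ) ^ 2 * D * (δ ^ 2 * q ^ 2) ≤ q ^ 2 * (δ ^ 2 * q ^ 2) := by gcongr
    nlinarith
  have h7 : μ ≤ q ^ 2 * δ / 2 := by
    rwa [sq_le_sq₀ hμ (by positivity)] at h4
  rw [div_le_iff₀ (by positivity)]
  linarith

/-- Crossing the unit interval around the integer `k` takes `2 q` steps. -/
lemma ConstSubmatrixBound.cross {D q N k : ℕ} (hq : 0 < q) (hqD : 8000 ^ 2 * D ≤ q ^ 2)
    (h : ConstSubmatrixBound D (k - 1 / 2) N) :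
    ConstSubmatrixBound D (k + 1 / 2) (N + 2 * q) := by
  have hq' : (0 : ℝ) < q := by exact_mod_cast hq
  have below : ∀ l : ℕ, l ≤ q →
      ConstSubmatrixBound D (k - ((q : ℝ) - l) ^ 2 / (2 * q ^ 2)) (N + l) := by
    intro l
    induction l with
    | zero =>
      intro _
      have e : (k : ℝ) - ((q : ℝ) - (0 : ℕ)) ^ 2 / (2 * q ^ 2) = k - 1 / 2 := by
        field_simp
        simp
        ring
      rw [e]
      exact h
    | succ l ih =>
      intro hl
      have hl' : (l : ℝ) + 1 ≤ q := by exact_mod_cast hl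
      push_cast
      have hsq : ((q : ℝ) - l) ^ 2 / (2 * q ^ 2) ≤ 1 / 2 := by
        rw [div_le_iff₀ (by positivity)]
        nlinarith [(Nat.cast_nonneg l : (0 : ℝ) ≤ l)]
      have hpos : 0 ≤ ((q : ℝ) - (l + 1)) ^ 2 / (2 * q ^ 2) := by positivity
      refine (ih (by omega)).step (k := k) (by linarith) (by linarith) ?_
      intro p δ _ hp2 h0 h1 h2
      have hd : ((q : ℝ) - (l + 1)) ^ 2 / (2 * q ^ 2) ≤ |p - k| := by
        rw [abs_sub_comm]
        exact (by linarith : _ ≤ (k : ℝ) - p).trans (le_abs_self _)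
      refine le_of_eq_of_le ?_ (grid_gap_le_drop hq hqD (by linarith) hd h0 h1 h2)
      field_simp
      ring
  have above : ∀ l : ℕ, l ≤ q →
      ConstSubmatrixBound D (k + (l : ℝ) ^ 2 / (2 * q ^ 2)) (N + q + l) := by
    intro l
    induction l with
    | zero =>
      intro _
      simpa using below q le_rfl
    | succ l ih =>
      intro hl
      have hl' : (l : ℝ) + 1 ≤ q := by exact_mod_cast hl
      push_cast
      have hsq : ((l : ℝ) + 1) ^ 2 / (2 * q ^ 2) ≤ 1 / 2 := by
        rw [div_le_iff₀ (by positivity)]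
        nlinarith [(Nat.cast_nonneg l : (0 : ℝ) ≤ l)]
      have hpos : 0 ≤ (l : ℝ) ^ 2 / (2 * q ^ 2) := by positivity
      refine (ih (by omega)).step (k := k) (by linarith) (by linarith) ?_
      intro p δ hp1 _ h0 h1 h2
      have hd : (l : ℝ) ^ 2 / (2 * q ^ 2) ≤ |p - k| :=
        (by linarith : _ ≤ p - (k : ℝ)).trans (le_abs_self _)
      refine le_of_eq_of_le ?_ (grid_gap_le_drop hq hqD (Nat.cast_nonneg l) hd h0 h1 h2)
      field_simp
      ring
  have e : (k : ℝ) + (q : ℝ) ^ 2 / (2 * q ^ 2) = k + 1 / 2 := by field_simp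
  rw [← e, show N + 2 * q = N + q + q by ring]
  exact above q le_rfl

lemma constSubmatrixBound_natCast {D q : ℕ} (hq : 0 < q) (hqD : 8000 ^ 2 * D ≤ q ^ 2) (k : ℕ) :
    ConstSubmatrixBound D (k + 1 / 2) (2 * q * (k + 1)) := by
  induction k with
  | zero =>
    -- No matrix of naturals has a negative average.
    have base : ConstSubmatrixBound D ((0 : ℕ) - 1 / 2) 0 := by
      intro ι κ _ _ _ _ M _ hM
      have hm : (0 : ℝ) < Fintype.card ι := by exact_mod_cast Fintype.card_pos
      have hn : (0 : ℝ) < Fintype.card κ := by exact_mod_cast Fintype.card_pos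
      have h0 : 0 ≤ ∑ i, ∑ j, (M i j : ℝ) := by positivity
      have : 0 < (Fintype.card ι : ℝ) * Fintype.card κ := by positivity
      simp only [Nat.cast_zero] at hM
      linarith
    simpa using base.cross hq hqD
  | succ k ih =>
    have e : (k : ℝ) + 1 / 2 = ((k + 1 : ℕ) : ℝ) - 1 / 2 := by push_cast; ring
    rw [e] at ih
    have h := ih.cross hq hqD
    rwa [show 2 * q * (k + 1) + 2 * q = 2 * q * (k + 1 + 1) by ring] at h

theorem mainTheorem10 :
    ∃ C : ℝ, 0 < C ∧
      ∀ (m n r : ℕ) (t : ℝ) (M : Matrix (Fin m) (Fin n) ℕ),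
        0 < m → 0 < n → 1 ≤ t → realRank M = r → averageEntry M ≤ t →
        ∃ (R : Finset (Fin m)) (S : Finset (Fin n)),
          IsConstantSubmatrix M R S ∧
          (2 : ℝ) ^ (-(C * t * Real.sqrt (r : ℝ))) * (m : ℝ) ≤ (R.card : ℝ) ∧
          (2 : ℝ) ^ (-(C * t * Real.sqrt (r : ℝ))) * (n : ℝ) ≤ (S.card : ℝ) := by
  refine ⟨1000000, by norm_num, fun m n r t M hm hn ht hr havg => ?_⟩
  rcases Nat.eq_zero_or_pos r with rfl | hrpos
  · -- Rank zero: the exponent vanishes, and so does the matrix.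
    have h0 : M.map (fun x : ℕ => (x : ℝ)) = 0 := by
      have h : Module.finrank ℝ (LinearMap.range
          (M.map (fun x : ℕ => (x : ℝ))).mulVecLin) = 0 := hr
      rw [Submodule.finrank_eq_zero, LinearMap.range_eq_bot] at h
      ext i j
      have := congrFun (LinearMap.congr_fun h (Pi.single j 1)) i
      simpa using this
    refine ⟨Finset.univ, Finset.univ, ⟨0, fun i _ j _ => ?_⟩, by simp, by simp⟩
    have := congrFun (congrFun h0 i) j
    simpa using this
  have : Nonempty (Fin m) := ⟨⟨0, hm⟩⟩
  have : Nonempty (Fin n) := ⟨⟨0, hn⟩⟩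
  have hr1 : (1 : ℝ) ≤ r := by exact_mod_cast hrpos
  have hsr : 1 ≤ Real.sqrt r := Real.one_le_sqrt.2 hr1
  have hsr2 : Real.sqrt r ^ 2 = r := Real.sq_sqrt (by linarith)
  -- `16000 ^ 2 r` exceeds `8000 ^ 2 (r + 1)`.
  set q : ℕ := ⌈16000 * Real.sqrt r⌉₊ with hqdef
  have hq1 : 16000 * Real.sqrt r ≤ q := Nat.le_ceil _
  have hq2 : (q : ℝ) < 16000 * Real.sqrt r + 1 := Nat.ceil_lt_add_one (by positivity)
  have hq : 0 < q := by
    have : (0 : ℝ) < q := by linarith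
    exact_mod_cast this
  have hqD : 8000 ^ 2 * (r + 1) ≤ q ^ 2 := by
    have : (8000 : ℝ) ^ 2 * (r + 1) ≤ q ^ 2 := by nlinarith
    exact_mod_cast this
  set k : ℕ := ⌈t⌉₊ with hkdef
  have hk1 : t ≤ k := Nat.le_ceil _
  have hk2 : (k : ℝ) < t + 1 := Nat.ceil_lt_add_one (by linarith)
  have hmn : (0 : ℝ) < (m : ℝ) * n := by
    have : 0 < m * n := Nat.mul_pos hm hn
    exact_mod_cast this
  obtain ⟨R, S, hc, hR, hS⟩ := constSubmatrixBound_natCast (D := r + 1) hq hqD k (Fin m) (Fin n) M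
    (Nat.add_le_add_right hr.le 1) (by
      have h := (div_le_iff₀ hmn).1 havg
      simp only [Fintype.card_fin]
      refine h.trans ?_
      gcongr
      linarith)
  refine ⟨R, S, hc, ?_⟩
  set N : ℕ := 2 * q * (k + 1) with hN
  have hNle : (2 : ℝ) * N + 2 ≤ 1000000 * t * Real.sqrt r := by
    have h1 : (q : ℝ) ≤ 16001 * Real.sqrt r := by linarith
    have h2 : (k : ℝ) + 1 ≤ 3 * t := by linarith
    have h3 : (q : ℝ) * (k + 1) ≤ 16001 * Real.sqrt r * (3 * t) := by gcongr
    have h4 : 1 ≤ t * Real.sqrt r := one_le_mul_of_one_le_of_one_le ht hsr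
    rw [hN]
    push_cast
    nlinarith
  have hpow : (4 : ℝ) * 3 ^ N ≤ 2 ^ (1000000 * t * Real.sqrt r) := by
    calc (4 : ℝ) * 3 ^ N ≤ 4 * 4 ^ N := by gcongr; norm_num
      _ = 2 ^ (2 * N + 2) := by rw [pow_add, pow_mul (2 : ℝ) 2 N]; norm_num [mul_comm]
      _ = 2 ^ ((2 : ℝ) * N + 2) := by rw [← Real.rpow_natCast]; push_cast; rfl
      _ ≤ _ := Real.rpow_le_rpow_of_exponent_le (by norm_num) hNle
  have conclude : ∀ a b : ℕ, a ≤ 4 * 3 ^ N * b →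
      (2 : ℝ) ^ (-(1000000 * t * Real.sqrt r)) * a ≤ b := by
    intro a b hab
    rw [Real.rpow_neg (by norm_num), inv_mul_le_iff₀ (by positivity)]
    have : (a : ℝ) ≤ 4 * 3 ^ N * b := by exact_mod_cast hab
    exact this.trans (by gcongr)
  simp only [Fintype.card_fin] at hR hS
  exact ⟨conclude m _ hR, conclude n _ hS⟩
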